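/- Let $n\ge 0$, let $\nu$ be a probability measure on $\{\pm1\}^n$, and let $X\sim\nu$. Write $m(\nu)=\mathbb{E}_\nu[X]\in\mathbb{R}^n$ for its mean. For $v\in\mathbb{R}^n$, let the tilt $\mathcal{T}_v\nu$ be the probability measure with $$\frac{d(\mathcal{T}_v\nu)}{d\nu}(x)=\frac{e^{\langle v,x\rangle}}{\mathbb{E}_\nu[e^{\langle v,X\rangle}]}.$$ For $u\in\{-1,0,1\}^n$, let the pinning $\mathcal{R}_u\nu$ be $\nu$ conditioned on the event that $X_i=u_i$ for all $i$ with $u_i\ne 0$; it is defined when this event has positive $\nu$-probability, in which case $u$ is called feasible. For a probability measure $\pi$ on $\{\pm1\}^n$, let $A(\pi)=\{i:\mathrm{Var}_\pi(X_i)>0\}$ and let the influence matrix $\Psi(\pi)$ be the matrix indexed by $A(\pi)\times A(\pi)$ with entries $\Psi(\pi)_{ij}=\mathrm{Cov}_\pi(X_i,X_j)/\mathrm{Var}_\pi(X_j)$; $\|\Psi(\pi)\|_{\mathrm{op}}$ is its $\ell_2\to\ell_2$ operator norm (equal to $0$ if $A(\pi)=\emptyset$). For $\mathcal{V}\subseteq\mathbb{R}^n$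 let $$\mathrm{sign}(\mathcal{V})=\bigl\{s\in\{-1,0,1\}^n:\ \exists v\in\mathcal{V}\ \text{with}\ s_i\in\{0,\mathrm{sign}(v_i)\}\ \text{for all } i\bigr\}.$$ **Proposition.** Let $\mathcal{V}\subseteq\mathbb{R}^n$ with $0\in\mathcal{V}$ and let $\alpha>0$. Suppose that $\nu$ is $\alpha$-$\ell_2$-independent restricted to $\mathrm{sign}(\mathcal{V})$, i.e. $\|\Psi(\mathcal{R}_u\nu)\|_{\mathrm{op}}\le\alpha$ for every feasible $u\in\mathrm{sign}(\mathcal{V})$. Then, for every $v\in\mathcal{V}$, $$\|m(\mathcal{T}_v\nu)-m(\nu)\|_2\le 4\alpha\|v\|_2.$$ -/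

import Mathlib

open MeasureTheory ProbabilityTheory

noncomputable section

namespace SparseLocalization

/-- The discrete cube `{±1}^n`. -/
abbrev Cube (n : ℕ) : Type := Fin n → ℤˣ

/-- The measurable structure that Mathlib puts on `{±1}` is the discrete one, hence so is the
product structure on the cube: every subset of the cube is an event. -/
instance instMeasurableSingletonClassIntUnits : MeasurableSingletonClass ℤˣ where
  measurableSet_singleton a :=
    ⟨{(a : ℤ)}, measurableSet_singleton _, by ext b; simp [Units.ext_iff]⟩

/-- A point of the cube, viewed as a vector of `ℝ^n` with the Euclidean norm. -/
def cubeVec {n : ℕ} (x : Cube n) : EuclideanSpace ℝ (Fin n) :=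
  WithLp.toLp 2 (fun i => ((x i : ℤ) : ℝ))

/-- The `i`-th coordinate `X_i`, as a real random variable on the cube. -/
def coord {n : ℕ} (i : Fin n) (x : Cube n) : ℝ := cubeVec x i

/-- The mean vector `m(ν) = 𝔼_ν[X]`. -/
def mean {n : ℕ} (ν : Measure (Cube n)) : EuclideanSpace ℝ (Fin n) :=
  WithLp.toLp 2 (fun i => ∫ x, coord i x ∂ν)

/-- The tilt `𝒯_v ν`: its density with respect to `ν` is `x ↦ e^⟨v, x⟩ / 𝔼_ν[e^⟨v, X⟩]`. -/
def tilt {n : ℕ} (v : EuclideanSpace ℝ (Fin n)) (ν : Measure (Cube n)) : Measure (Cube n) :=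
  ν.tilted (fun x => inner ℝ v (cubeVec x))

/-- The event that `X_i = u_i` for all `i` with `u_i ≠ 0`. -/
def pinEvent {n : ℕ} (u : Fin n → SignType) : Set (Cube n) :=
  {x | ∀ i, u i ≠ 0 → coord i x = ((u i : SignType) : ℝ)}

/-- The pinning `u` is feasible for `ν`: the conditioning event has positive probability. -/
def Feasible {n : ℕ} (ν : Measure (Cube n)) (u : Fin n → SignType) : Prop :=
  0 < ν (pinEvent u)

/-- The pinning `ℛ_u ν`, that is, `ν` conditioned on `pinEvent u`. It is meaningful for
feasible `u` only. -/
def pin {n : ℕ} (u : Fin n → SignType) (ν : Measure (Cube n)) : Measure (Cube n) :=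
  ν[|pinEvent u]

/-- `sign(𝒱)`: the downward closure of the set of sign vectors of elements of `𝒱`. -/
def signClosure {n : ℕ} (V : Set (EuclideanSpace ℝ (Fin n))) : Set (Fin n → SignType) :=
  {s | ∃ v ∈ V, ∀ i, s i = 0 ∨ s i = SignType.sign (v i)}

/-- The covariance matrix `Cov(ν)_{ij} = Cov_ν(X_i, X_j)`. -/
def covMatrix {n : ℕ} (ν : Measure (Cube n)) : Matrix (Fin n) (Fin n) ℝ :=
  Matrix.of fun i j => cov[coord i, coord j; ν]

/-- The active coordinates of `ν`: those with positive variance. -/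
def active {n : ℕ} (ν : Measure (Cube n)) : Set (Fin n) :=
  {i | 0 < Var[coord i; ν]}

open Classical in
/-- The influence matrix `Ψ(ν) = Cov(ν) diag(Var_ν(X_i))⁻¹`, on the active coordinates of `ν`. -/
def influence {n : ℕ} (ν : Measure (Cube n)) : Matrix (active ν) (active ν) ℝ :=
  (covMatrix ν).submatrix Subtype.val Subtype.val *
    Matrix.diagonal (fun j : active ν => (Var[coord j.1; ν])⁻¹)

open Classical in
/-- The `ℓ₂ → ℓ₂` operator norm of the influence matrix, on the active subspace. -/
def influenceOpNorm {n : ℕ} (ν : Measure (Cube n)) : ℝ :=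
  ‖Matrix.toEuclideanCLM (n := active ν) (𝕜 := ℝ) (influence ν)‖

/-- `ν` is `α`-`ℓ₂`-independent restricted to `S`: `‖Ψ(ℛ_u ν)‖_op ≤ α` for all `u ∈ S` for which
the pinning `ℛ_u ν` is defined. -/
def IsL2IndependentOn {n : ℕ} (ν : Measure (Cube n)) (α : ℝ) (S : Set (Fin n → SignType)) : Prop :=
  ∀ u ∈ S, Feasible ν u → influenceOpNorm (pin u ν) ≤ α

end SparseLocalization

end

open SparseLocalization

namespace SparseLocalization

/-! Fix a linear functional φ = ⟨y, ·⟩ and let f_u(t) be its mean under the tv-tilt of the pinning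
u, with u agreeing with sign(v) where nonzero. Since v_i X_i = |v_i|(2·1[X_i = sign v_i] − 1),
differentiating in t pins one more coordinate (`hasDerivAt_pinnedTiltMean`): f_u' = Σ r_i(t)(f_{u+i}
− f_u), with 0 ≤ r_i ≤ 2|v_i|. Independence is assumed only for untilted pinnings. At t = 0 it
controls every such combination of differences by C = 4α‖v‖‖y‖ (`sum_pinnedTiltMean_sub_le`). A
barrier argument, by induction on the number of free coordinates, carries this to t > 0
(`pinnedTiltMean_sub_le`): where f_u first threatens to outgrow f_u(0) + Ct, the children f_{u+i}
have grown no faster, so the tilted differences are at most the untilted ones. The theorem follows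
with u = 0, t = 1 and y the mean displacement. -/

variable {n : ℕ}

/-! ### Coordinates on the cube and the influence matrix as a bilinear form. -/

lemma sq_coord (i : Fin n) (x : Cube n) : coord i x ^ 2 = 1 := by
  rcases Int.units_eq_one_or (x i) with h | h <;> simp [coord, cubeVec, h]

lemma inner_cubeVec (v : EuclideanSpace ℝ (Fin n)) (x : Cube n) :
    inner ℝ v (cubeVec x) = ∑ i, v i * coord i x := by
  simp [PiLp.inner_apply, coord, mul_comm]

lemma memLp_two_of_cube (π : Measure (Cube n)) [IsFiniteMeasure π] (f : Cube n → ℝ) :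
    MemLp f 2 π :=
  MemLp.of_discrete

lemma covariance_eq_zero_of_variance_eq_zero (π : Measure (Cube n)) [IsFiniteMeasure π]
    (f g : Cube n → ℝ) (hf : Var[f; π] = 0) : cov[f, g; π] = 0 := by
  have h := ae_eq_integral_of_variance_eq_zero (memLp_two_of_cube π f) hf
  rw [covariance]
  refine integral_eq_zero_of_ae ?_
  filter_upwards [h] with x hx
  simp [hx]

lemma variance_coord (π : Measure (Cube n)) [IsProbabilityMeasure π] (i : Fin n) :
    Var[coord i; π] = 1 - (∫ x, coord i x ∂π) ^ 2 := by
  rw [variance_eq_sub (memLp_two_of_cube π _)]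
  simp [sq_coord]

/-- The sum is ⟨y, Ψ(π) w⟩ on the active coordinates: inactive ones contribute zero, and restricting
y and w only shrinks their norms. -/
lemma sum_covariance_le_influenceOpNorm (π : Measure (Cube n)) [IsProbabilityMeasure π]
    (y w : EuclideanSpace ℝ (Fin n)) :
    ∑ i, w i * (Var[coord i; π])⁻¹ * cov[fun x => inner ℝ y (cubeVec x), coord i; π]
      ≤ influenceOpNorm π * ‖y‖ * ‖w‖ := by
  classical
  have hinact : ∀ i, i ∉ active π → Var[coord i; π] = 0 := fun i hi =>
    le_antisymm (not_lt.1 hi) (variance_nonneg _ _)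
  have hres : ∀ z : EuclideanSpace ℝ (Fin n),
      ‖(WithLp.toLp 2 (fun i : active π => z i.1) : EuclideanSpace ℝ (active π))‖ ≤ ‖z‖ := by
    intro z
    rw [EuclideanSpace.norm_eq, EuclideanSpace.norm_eq]
    refine Real.sqrt_le_sqrt ?_
    rw [← Finset.sum_subtype (Finset.univ.filter (· ∈ active π)) (by simp) fun i => ‖z i‖ ^ 2]
    exact Finset.sum_le_sum_of_subset_of_nonneg (Finset.filter_subset _ _)
      fun _ _ _ => by positivity
  set y' : EuclideanSpace ℝ (active π) := WithLp.toLp 2 (fun i => y i.1)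
  set w' : EuclideanSpace ℝ (active π) := WithLp.toLp 2 (fun i => w i.1)
  have key : ∑ i, w i * (Var[coord i; π])⁻¹ * cov[fun x => inner ℝ y (cubeVec x), coord i; π]
      = inner ℝ y' (Matrix.toEuclideanCLM (n := active π) (𝕜 := ℝ) (influence π) w') := by
    have hsub : ∀ f : Fin n → ℝ, (∀ i, i ∉ active π → f i = 0) →
        ∑ i, f i = ∑ i : active π, f i := by
      intro f hf
      rw [← Finset.sum_subtype (Finset.univ.filter (· ∈ active π)) (by simp) f]
      exact (Finset.sum_subset (Finset.filter_subset _ _)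
        fun i _ hi => hf i (by simpa using hi)).symm
    have hcov : ∀ i, cov[fun x => inner ℝ y (cubeVec x), coord i; π]
        = ∑ j : active π, y j * cov[coord j, coord i; π] := by
      intro i
      simp only [inner_cubeVec]
      rw [covariance_fun_sum_left (fun j => memLp_two_of_cube π _) (memLp_two_of_cube π _)]
      simp only [covariance_const_mul_left]
      refine hsub (fun j => y j * cov[coord j, coord i; π]) fun j hj => ?_
      rw [covariance_eq_zero_of_variance_eq_zero π _ _ (hinact j hj), mul_zero]
    have hentry : ∀ a b, influence π a b = cov[coord a.1, coord b.1; π] * (Var[coord b.1; π])⁻¹ := by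
      intro a b
      rw [influence, Matrix.mul_diagonal]
      rfl
    rw [hsub _ fun i hi => by simp [hinact i hi], Matrix.inner_toEuclideanCLM]
    simp only [dotProduct, Matrix.mulVec, hentry, hcov, Finset.mul_sum]
    rw [Finset.sum_comm]
    refine Finset.sum_congr rfl fun a _ => Finset.sum_congr rfl fun b _ => ?_
    simp only [y', w']
    ring
  rw [key]
  calc _ ≤ ‖y'‖ * ‖Matrix.toEuclideanCLM (n := active π) (𝕜 := ℝ) (influence π) w'‖ :=
        real_inner_le_norm _ _
    _ ≤ ‖y‖ * (influenceOpNorm π * ‖w‖) := by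
        gcongr
        · exact hres y
        · refine (ContinuousLinearMap.le_opNorm _ _).trans ?_
          have : influenceOpNorm π
            = ‖Matrix.toEuclideanCLM (n := active π) (𝕜 := ℝ) (influence π)‖ := rfl
          rw [this]
          gcongr
          exact hres w
    _ = _ := by ring

/-! ### Tilted means over pinned subcubes and their derivatives. -/

/-- The integral over the pinned cube of `φ` against the unnormalised tilt `e^{t⟨v, x⟩} dν`. -/
noncomputable def pinnedTiltSum (ν : Measure (Cube n)) (v : EuclideanSpace ℝ (Fin n))
    (u : Fin n → SignType) (φ : Cube n → ℝ) (t : ℝ) : ℝ :=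
  ∑ x, (pinEvent u).indicator
    (fun x => ν.real {x} * Real.exp (t * inner ℝ v (cubeVec x)) * φ x) x

/-- The mean of `φ` under the `t v`-tilt of the pinning `ℛ_u ν`. -/
noncomputable def pinnedTiltMean (ν : Measure (Cube n)) (v : EuclideanSpace ℝ (Fin n))
    (u : Fin n → SignType) (φ : Cube n → ℝ) (t : ℝ) : ℝ :=
  pinnedTiltSum ν v u φ t / pinnedTiltSum ν v u (fun _ => 1) t

lemma hasDerivAt_pinnedTiltSum (ν : Measure (Cube n)) (v : EuclideanSpace ℝ (Fin n))
    (u : Fin n → SignType) (φ : Cube n → ℝ) (t : ℝ) :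
    HasDerivAt (pinnedTiltSum ν v u φ)
      (pinnedTiltSum ν v u (fun x => φ x * inner ℝ v (cubeVec x)) t) t := by
  unfold pinnedTiltSum
  refine HasDerivAt.fun_sum fun x _ => ?_
  by_cases hx : x ∈ pinEvent u
  · simp only [Set.indicator_of_mem hx]
    have h := ((((hasDerivAt_id t).mul_const (inner ℝ v (cubeVec x))).exp).const_mul
      (ν.real {x})).mul_const (φ x)
    refine h.congr_deriv ?_
    simp only [id]
    ring
  · simp only [Set.indicator_of_notMem hx]
    exact hasDerivAt_const _ _

lemma mem_pinEvent_update {v : EuclideanSpace ℝ (Fin n)} {u : Fin n → SignType}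
    (hu : ∀ i, u i = 0 ∨ u i = SignType.sign (v i)) {i : Fin n} (hi : v i ≠ 0) (x : Cube n) :
    x ∈ pinEvent (Function.update u i (SignType.sign (v i))) ↔
      x ∈ pinEvent u ∧ coord i x = ((SignType.sign (v i) : SignType) : ℝ) := by
  constructor
  · intro h
    have hx : coord i x = ((SignType.sign (v i) : SignType) : ℝ) := by
      have := h i
      simp only [Function.update_self] at this
      exact this (by simpa [sign_eq_zero_iff] using hi)
    refine ⟨fun j hj => ?_, hx⟩
    by_cases hji : j = i
    · subst hji
      rw [(hu j).resolve_left hj, hx]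
    · have := h j
      simp only [Function.update_of_ne hji] at this
      exact this hj
  · rintro ⟨h, hx⟩ j hj
    by_cases hji : j = i
    · subst hji
      simpa using hx
    · simp only [Function.update_of_ne hji] at hj ⊢
      exact h j hj

lemma sq_sign {a : ℝ} (ha : a ≠ 0) : ((SignType.sign a : SignType) : ℝ) ^ 2 = 1 := by
  rcases lt_or_gt_of_ne ha with h | h <;> simp [h]

/-- For s = ±1, the indicator of X_i = s on the cube is (1 + s X_i)/2. -/
lemma pinnedTiltSum_update (ν : Measure (Cube n)) {v : EuclideanSpace ℝ (Fin n)}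
    {u : Fin n → SignType} (hu : ∀ i, u i = 0 ∨ u i = SignType.sign (v i)) {i : Fin n}
    (hi : v i ≠ 0) (φ : Cube n → ℝ) (t : ℝ) :
    pinnedTiltSum ν v (Function.update u i (SignType.sign (v i))) φ t =
      pinnedTiltSum ν v u
        (fun x => φ x * ((1 + ((SignType.sign (v i) : SignType) : ℝ) * coord i x) / 2)) t := by
  unfold pinnedTiltSum
  refine Finset.sum_congr rfl fun x _ => ?_
  have hs := sq_sign hi
  set s := ((SignType.sign (v i) : SignType) : ℝ)
  by_cases hx : x ∈ pinEvent u
  · by_cases hc : coord i x = s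
    · rw [Set.indicator_of_mem ((mem_pinEvent_update hu hi x).2 ⟨hx, hc⟩),
        Set.indicator_of_mem hx]
      simp only [hc, ← sq, hs]
      ring
    · rw [Set.indicator_of_notMem (fun h => hc ((mem_pinEvent_update hu hi x).1 h).2),
        Set.indicator_of_mem hx]
      have : coord i x = -s := by
        have h := sq_coord i x
        rw [← hs, sq_eq_sq_iff_eq_or_eq_neg] at h
        exact h.resolve_left hc
      simp only [this]
      linear_combination (ν.real {x} * Real.exp (t * inner ℝ v (cubeVec x)) * φ x / 2) * hs
  · rw [Set.indicator_of_notMem (fun h => hx ((mem_pinEvent_update hu hi x).1 h).1),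
      Set.indicator_of_notMem hx]

lemma pinnedTiltSum_sum {ι : Type*} (s : Finset ι) (ν : Measure (Cube n))
    (v : EuclideanSpace ℝ (Fin n)) (u : Fin n → SignType) (φ : ι → Cube n → ℝ) (t : ℝ) :
    pinnedTiltSum ν v u (fun x => ∑ i ∈ s, φ i x) t = ∑ i ∈ s, pinnedTiltSum ν v u (φ i) t := by
  unfold pinnedTiltSum
  rw [Finset.sum_comm]
  refine Finset.sum_congr rfl fun x _ => ?_
  by_cases hx : x ∈ pinEvent u
  · simp [hx, Finset.mul_sum]
  · simp [hx]

lemma pinnedTiltSum_mul_inner (ν : Measure (Cube n)) {v : EuclideanSpace ℝ (Fin n)}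
    {u : Fin n → SignType} (hu : ∀ i, u i = 0 ∨ u i = SignType.sign (v i))
    (φ : Cube n → ℝ) (t : ℝ) :
    pinnedTiltSum ν v u (fun x => φ x * inner ℝ v (cubeVec x)) t =
      ∑ i, |v i| * (2 * pinnedTiltSum ν v (Function.update u i (SignType.sign (v i))) φ t
        - pinnedTiltSum ν v u φ t) := by
  simp only [inner_cubeVec, Finset.mul_sum]
  simp only [pinnedTiltSum_sum Finset.univ ν v u (fun i x => φ x * (v i * coord i x)) t]
  refine Finset.sum_congr rfl fun i _ => ?_
  by_cases hi : v i = 0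
  · simp [hi, pinnedTiltSum]
  rw [pinnedTiltSum_update ν hu hi]
  unfold pinnedTiltSum
  rw [Finset.mul_sum, ← Finset.sum_sub_distrib, Finset.mul_sum]
  refine Finset.sum_congr rfl fun x _ => ?_
  by_cases hx : x ∈ pinEvent u
  · simp only [Set.indicator_of_mem hx, inner_cubeVec]
    have h : ((SignType.sign (v i) : SignType) : ℝ) * |v i| = v i := sign_mul_abs (v i)
    linear_combination (-ν.real {x} * Real.exp (t * ∑ i, v i * coord i x) * φ x * coord i x) * h
  · simp [hx]

lemma pinnedTiltSum_pos {ν : Measure (Cube n)} [IsFiniteMeasure ν] {u : Fin n → SignType}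
    (hu : Feasible ν u) (v : EuclideanSpace ℝ (Fin n)) (t : ℝ) :
    0 < pinnedTiltSum ν v u (fun _ => 1) t := by
  unfold pinnedTiltSum
  obtain ⟨x, hx, hx0⟩ : ∃ x ∈ pinEvent u, ν {x} ≠ 0 := by
    by_contra! h
    have : ν (pinEvent u) = 0 := by
      rw [← Set.biUnion_of_singleton (pinEvent u)]
      exact (measure_biUnion_null_iff (Set.to_countable _)).2 h
    exact hu.ne' this
  refine Finset.sum_pos' (fun x _ => Set.indicator_nonneg (fun x _ => by positivity) x)
    ⟨x, Finset.mem_univ _, ?_⟩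
  rw [Set.indicator_of_mem hx]
  have : 0 < ν.real {x} := ENNReal.toReal_pos hx0 (measure_ne_top _ _)
  positivity

lemma pinnedTiltSum_eq_zero {ν : Measure (Cube n)} {u : Fin n → SignType}
    (hu : ¬ Feasible ν u) (v : EuclideanSpace ℝ (Fin n)) (φ : Cube n → ℝ) (t : ℝ) :
    pinnedTiltSum ν v u φ t = 0 := by
  refine Finset.sum_eq_zero fun x _ => Set.indicator_apply_eq_zero.2 fun hx => ?_
  have h0 : ν (pinEvent u) = 0 := by simpa [Feasible] using hu
  have : ν {x} = 0 := measure_mono_null (Set.singleton_subset_iff.2 hx) h0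
  simp [Measure.real, this]

lemma pinnedTiltSum_one_nonneg (ν : Measure (Cube n)) (u : Fin n → SignType)
    (v : EuclideanSpace ℝ (Fin n)) (t : ℝ) : 0 ≤ pinnedTiltSum ν v u (fun _ => 1) t :=
  Finset.sum_nonneg fun x _ => Set.indicator_nonneg (fun x _ => by positivity) x

/-- The quotient rule gives the tilted covariance of φ with ⟨v, X⟩. After `pinnedTiltSum_mul_inner`
the constant parts −|v_i| cancel. An infeasible child has a meaningless mean, but its weight is
zero. -/
lemma hasDerivAt_pinnedTiltMean (ν : Measure (Cube n)) [IsFiniteMeasure ν]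
    {v : EuclideanSpace ℝ (Fin n)} {u : Fin n → SignType}
    (hu : ∀ i, u i = 0 ∨ u i = SignType.sign (v i)) (hf : Feasible ν u)
    (φ : Cube n → ℝ) (t : ℝ) :
    HasDerivAt (pinnedTiltMean ν v u φ)
      (∑ i, 2 * |v i| * (pinnedTiltSum ν v (Function.update u i (SignType.sign (v i)))
          (fun _ => 1) t / pinnedTiltSum ν v u (fun _ => 1) t) *
        (pinnedTiltMean ν v (Function.update u i (SignType.sign (v i))) φ t
          - pinnedTiltMean ν v u φ t)) t := by
  have hZ := (pinnedTiltSum_pos hf v t).ne'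
  refine ((hasDerivAt_pinnedTiltSum ν v u φ t).div
    (hasDerivAt_pinnedTiltSum ν v u (fun _ => 1) t) hZ).congr_deriv ?_
  rw [pinnedTiltSum_mul_inner ν hu, pinnedTiltSum_mul_inner ν hu, Finset.sum_mul, Finset.mul_sum,
    ← Finset.sum_sub_distrib, Finset.sum_div]
  refine Finset.sum_congr rfl fun i _ => ?_
  unfold pinnedTiltMean
  by_cases hfi : Feasible ν (Function.update u i (SignType.sign (v i)))
  · have hZi := (pinnedTiltSum_pos hfi v t).ne'
    field_simp
    ring
  · simp only [pinnedTiltSum_eq_zero hfi]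
    field_simp
    ring

lemma pinnedTiltSum_update_le (ν : Measure (Cube n)) {v : EuclideanSpace ℝ (Fin n)}
    {u : Fin n → SignType} (hu : ∀ i, u i = 0 ∨ u i = SignType.sign (v i)) {i : Fin n}
    (hi : v i ≠ 0) (t : ℝ) :
    pinnedTiltSum ν v (Function.update u i (SignType.sign (v i))) (fun _ => 1) t ≤
      pinnedTiltSum ν v u (fun _ => 1) t := by
  refine Finset.sum_le_sum fun x _ => ?_
  exact Set.indicator_le_indicator_of_subset
    (fun x hx => ((mem_pinEvent_update hu hi x).1 hx).1) (fun x => by positivity) x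

/-! ### Integrals against pinnings and tilts. -/

lemma integral_pin {ν : Measure (Cube n)} [IsFiniteMeasure ν] (u : Fin n → SignType)
    (v : EuclideanSpace ℝ (Fin n)) (φ : Cube n → ℝ) :
    ∫ x, φ x ∂(pin u ν) = pinnedTiltMean ν v u φ 0 := by
  have h : ∀ ψ : Cube n → ℝ, ∫ x in pinEvent u, ψ x ∂ν = pinnedTiltSum ν v u ψ 0 := by
    intro ψ
    rw [← integral_indicator (Set.toFinite _).measurableSet,
      integral_fintype Integrable.of_finite]
    refine Finset.sum_congr rfl fun x _ => ?_
    by_cases hx : x ∈ pinEvent u <;> simp [hx]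
  rw [pin, ProbabilityTheory.cond, integral_smul_measure, h φ, pinnedTiltMean, ← h (fun _ => 1)]
  simp [Measure.real, div_eq_inv_mul]

lemma integral_tilt (ν : Measure (Cube n)) [IsFiniteMeasure ν] (v : EuclideanSpace ℝ (Fin n))
    (φ : Cube n → ℝ) : ∫ x, φ x ∂(tilt v ν) = pinnedTiltMean ν v 0 φ 1 := by
  rw [tilt, integral_tilted, pinnedTiltMean]
  simp only [pinnedTiltSum]
  rw [integral_fintype Integrable.of_finite, integral_fintype Integrable.of_finite, Finset.sum_div]
  have : pinEvent (0 : Fin n → SignType) = Set.univ := by ext; simp [pinEvent]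
  simp only [this, Set.indicator_univ, smul_eq_mul, one_mul, mul_one]
  refine Finset.sum_congr rfl fun x _ => ?_
  ring

lemma inner_mean (π : Measure (Cube n)) [IsFiniteMeasure π] (y : EuclideanSpace ℝ (Fin n)) :
    inner ℝ y (mean π) = ∫ x, inner ℝ y (cubeVec x) ∂π := by
  simp only [inner_cubeVec]
  rw [integral_finsetSum _ fun i _ => Integrable.of_finite]
  simp only [integral_const_mul]
  simp [PiLp.inner_apply, mean, mul_comm]


/-! ### The untilted bound. -/

/-- With s_i = sign v_i and m_i the pinned mean, conditioning on X_i = s_i shifts the mean of φ by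
s_i Cov(φ, X_i)/(1 + s_i m_i). As Var(X_i) = (1 − s_i m_i)(1 + s_i m_i), the sum is the influence
form with w_i = s_i r_i (1 − s_i m_i). The 4 is 2 from r_i ≤ 2|v_i| times 2 from |1 − s_i m_i| ≤ 2.
-/
lemma sum_pinnedTiltMean_sub_le {ν : Measure (Cube n)} [IsFiniteMeasure ν]
    {v : EuclideanSpace ℝ (Fin n)} {u : Fin n → SignType}
    (hu : ∀ i, u i = 0 ∨ u i = SignType.sign (v i)) (hf : Feasible ν u)
    (y : EuclideanSpace ℝ (Fin n)) (r : Fin n → ℝ) (hr0 : ∀ i, 0 ≤ r i)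
    (hr : ∀ i, r i ≤ 2 * |v i|)
    (hrf : ∀ i, ¬ Feasible ν (Function.update u i (SignType.sign (v i))) → r i = 0) :
    ∑ i, r i * (pinnedTiltMean ν v (Function.update u i (SignType.sign (v i)))
        (fun x => inner ℝ y (cubeVec x)) 0
        - pinnedTiltMean ν v u (fun x => inner ℝ y (cubeVec x)) 0) ≤
      influenceOpNorm (pin u ν) * ‖y‖ * (4 * ‖v‖) := by
  set φ : Cube n → ℝ := fun x => inner ℝ y (cubeVec x)
  set π := pin u ν with hπ
  have : IsProbabilityMeasure π := cond_isProbabilityMeasure hf.ne'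
  set s : Fin n → ℝ := fun i => ((SignType.sign (v i) : SignType) : ℝ) with hs_def
  set m : Fin n → ℝ := fun i => ∫ x, coord i x ∂π with hm_def
  have hs : ∀ i, |s i| ≤ 1 := by
    intro i
    rcases lt_trichotomy (v i) 0 with h | h | h <;> simp [hs_def, h]
  have hm : ∀ i, |m i| ≤ 1 := by
    intro i
    have := variance_nonneg (coord i) π
    rw [variance_coord] at this
    exact (sq_le_one_iff_abs_le_one _).1 (by linarith)
  set w : EuclideanSpace ℝ (Fin n) := WithLp.toLp 2 (fun i => s i * r i * (1 - s i * m i))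
    with hw_def
  have hw : ‖w‖ ≤ 4 * ‖v‖ := by
    have h4 : 4 * ‖v‖ = ‖(4 : ℝ) • v‖ := by rw [norm_smul]; norm_num
    rw [h4, EuclideanSpace.norm_eq, EuclideanSpace.norm_eq]
    refine Real.sqrt_le_sqrt (Finset.sum_le_sum fun i _ => ?_)
    gcongr
    have hsm : |1 - s i * m i| ≤ 2 := by
      have : |s i * m i| ≤ 1 := by
        rw [abs_mul]
        exact mul_le_one₀ (hs i) (abs_nonneg _) (hm i)
      rw [abs_le] at this ⊢
      constructor <;> linarith [this.1, this.2]
    have hri : |r i| ≤ 2 * |v i| := by rw [abs_of_nonneg (hr0 i)]; exact hr i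
    simp only [hw_def, PiLp.smul_apply, norm_smul, Real.norm_eq_abs, abs_mul]
    calc |s i| * |r i| * |1 - s i * m i| ≤ 1 * (2 * |v i|) * 2 := by
          gcongr
          exact hs i
      _ = _ := by norm_num; ring
  have hterm : ∀ i, r i * (pinnedTiltMean ν v (Function.update u i (SignType.sign (v i))) φ 0
        - pinnedTiltMean ν v u φ 0) = w i * (Var[coord i; π])⁻¹ * cov[φ, coord i; π] := by
    intro i
    have hwi : w i = s i * r i * (1 - s i * m i) := rfl
    by_cases hri : r i = 0
    · simp [hri, hwi]
    have hvi : v i ≠ 0 := fun h => hri (le_antisymm (by simpa [h] using hr i) (hr0 i))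
    have hfi := not_imp_comm.1 (hrf i) hri
    have hZ := (pinnedTiltSum_pos hf v 0).ne'
    have hquot : ∀ ψ : Cube n → ℝ,
        pinnedTiltSum ν v (Function.update u i (SignType.sign (v i))) ψ 0
          = pinnedTiltSum ν v u (fun _ => 1) 0 *
            ((∫ x, ψ x ∂π + s i * ∫ x, ψ x * coord i x ∂π) / 2) := by
      intro ψ
      have h : ∫ x, ψ x * ((1 + s i * coord i x) / 2) ∂π
          = (∫ x, ψ x ∂π + s i * ∫ x, ψ x * coord i x ∂π) / 2 := by
        rw [← integral_const_mul, ← integral_add Integrable.of_finite Integrable.of_finite,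
          ← integral_div]
        congr 1 with x
        ring
      rw [← h, integral_pin u v, pinnedTiltMean, pinnedTiltSum_update ν hu hvi,
        mul_div_cancel₀ _ hZ]
    have hpos := (pinnedTiltSum_pos hfi v 0).ne'
    have hs2 : s i ^ 2 = 1 := sq_sign hvi
    have hmean : pinnedTiltMean ν v (Function.update u i (SignType.sign (v i))) φ 0
        = (∫ x, φ x ∂π + s i * ∫ x, φ x * coord i x ∂π) / (1 + s i * m i) := by
      rw [pinnedTiltMean, hquot, hquot, mul_div_mul_left _ _ hZ]
      simp [hm_def, div_div_div_cancel_right₀]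
    have hden : 1 + s i * m i ≠ 0 := by
      intro h0
      apply hpos
      rw [hquot]
      simp only [integral_const, probReal_univ, one_smul, one_mul]
      rw [show ∫ x, coord i x ∂π = m i from rfl, h0]
      simp
    rw [hmean, ← integral_pin u v φ, ← hπ, hwi]
    have hcov : cov[φ, coord i; π] = ∫ x, φ x * coord i x ∂π - (∫ x, φ x ∂π) * m i := by
      rw [covariance_eq_sub (memLp_two_of_cube π _) (memLp_two_of_cube π _)]
      rfl
    have hdiff : (∫ x, φ x ∂π + s i * ∫ x, φ x * coord i x ∂π) / (1 + s i * m i) - ∫ x, φ x ∂π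
        = s i * cov[φ, coord i; π] / (1 + s i * m i) := by
      rw [hcov]
      field_simp
      ring
    rw [hdiff]
    -- If X_i is already constant under π, the covariance vanishes and both sides are zero.
    by_cases hvar : Var[coord i; π] = 0
    · rw [covariance_comm, covariance_eq_zero_of_variance_eq_zero π _ _ hvar]
      simp
    · have hfac : Var[coord i; π] = (1 - s i * m i) * (1 + s i * m i) := by
        rw [variance_coord]
        linear_combination (m i) ^ 2 * hs2
      rw [hfac] at hvar ⊢
      have := left_ne_zero_of_mul hvar
      field_simp
  calc _ = ∑ i, w i * (Var[coord i; π])⁻¹ * cov[φ, coord i; π] :=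
        Finset.sum_congr rfl fun i _ => hterm i
    _ ≤ influenceOpNorm π * ‖y‖ * ‖w‖ := sum_covariance_le_influenceOpNorm π y w
    _ ≤ _ := by
        have : 0 ≤ influenceOpNorm π := by
          unfold influenceOpNorm
          classical exact norm_nonneg (Matrix.toEuclideanCLM (n := active π) (𝕜 := ℝ) (influence π))
        gcongr

/-! ### From untilted to tilted: the barrier argument. -/

lemma pinnedTiltMean_sub_le {ν : Measure (Cube n)} [IsFiniteMeasure ν]
    {v : EuclideanSpace ℝ (Fin n)} {α : ℝ}
    (hν : ∀ u : Fin n → SignType, (∀ i, u i = 0 ∨ u i = SignType.sign (v i)) →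
      Feasible ν u → influenceOpNorm (pin u ν) ≤ α)
    (y : EuclideanSpace ℝ (Fin n)) (u : Fin n → SignType)
    (hu : ∀ i, u i = 0 ∨ u i = SignType.sign (v i)) (hf : Feasible ν u)
    {t : ℝ} (ht : 0 ≤ t) :
    pinnedTiltMean ν v u (fun x => inner ℝ y (cubeVec x)) t
      - pinnedTiltMean ν v u (fun x => inner ℝ y (cubeVec x)) 0 ≤ 4 * α * ‖v‖ * ‖y‖ * t := by
  induction hk : (Finset.univ.filter fun i => u i = 0 ∧ v i ≠ 0).card
    using Nat.strong_induction_on generalizing u t with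
  | _ k ih =>
  set φ : Cube n → ℝ := fun x => inner ℝ y (cubeVec x)
  set C := 4 * α * ‖v‖ * ‖y‖ with hC
  have hupd : ∀ i j, Function.update u i (SignType.sign (v i)) j = 0 ∨
      Function.update u i (SignType.sign (v i)) j = SignType.sign (v j) := by
    intro i j
    by_cases hji : j = i
    · subst hji; simp
    · simpa [Function.update_of_ne hji] using hu j
  set r : Fin n → ℝ → ℝ := fun i t => 2 * |v i| *
    (pinnedTiltSum ν v (Function.update u i (SignType.sign (v i))) (fun _ => 1) t /
      pinnedTiltSum ν v u (fun _ => 1) t) with hr_def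
  have hr0 : ∀ i t, 0 ≤ r i t := fun i t => mul_nonneg (by positivity)
    (div_nonneg (pinnedTiltSum_one_nonneg _ _ _ _) (pinnedTiltSum_one_nonneg _ _ _ _))
  have hr : ∀ i t, r i t ≤ 2 * |v i| := by
    intro i t
    by_cases hi : v i = 0
    · simp [hr_def, hi]
    · exact mul_le_of_le_one_right (by positivity)
        (div_le_one_of_le₀ (pinnedTiltSum_update_le ν hu hi t) (pinnedTiltSum_one_nonneg _ _ _ _))
  have hrf : ∀ i t, ¬ Feasible ν (Function.update u i (SignType.sign (v i))) → r i t = 0 := by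
    intro i t h
    simp [hr_def, pinnedTiltSum_eq_zero h]
  -- The barrier needs slope C + δ, since the derivative must be strictly smaller at contact.
  refine le_of_forall_pos_le_add fun ε hε => ?_
  obtain ⟨δ, hδ, hδε⟩ : ∃ δ > 0, δ * t ≤ ε :=
    ⟨ε / (t + 1), by positivity, by rw [div_mul_eq_mul_div, div_le_iff₀ (by positivity)]; nlinarith⟩
  have hder := fun t => (hasDerivAt_pinnedTiltMean ν hu hf φ t).sub_const (pinnedTiltMean ν v u φ 0)
  have hfence := image_le_of_deriv_right_lt_deriv_boundary (a := 0) (b := t)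
    (fun x _ => (hder x).continuousAt.continuousWithinAt)
    (fun x _ => (hder x).hasDerivWithinAt) (B := fun x => (C + δ) * x) (B' := fun _ => C + δ)
    (by simp) (fun x => by simpa using (hasDerivAt_id x).const_mul (C + δ)) ?_
    (Set.right_mem_Icc.2 ht)
  · linarith
  rintro x ⟨hx0, -⟩ hx
  have hsource := sum_pinnedTiltMean_sub_le hu hf y (fun i => r i x) (fun i => hr0 i x)
    (fun i => hr i x) (fun i => hrf i x)
  have hop : influenceOpNorm (pin u ν) * ‖y‖ * (4 * ‖v‖) ≤ C := by
    calc _ ≤ α * ‖y‖ * (4 * ‖v‖) := by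
          gcongr
          exact hν u hu hf
      _ = C := by rw [hC]; ring
  -- At a contact point x, f_u has grown by exactly (C + δ)x and a child by at most Cx, so each
  -- difference is at most its value at 0.
  refine lt_of_le_of_lt ((Finset.sum_le_sum fun i _ => ?_).trans (hsource.trans hop))
    (lt_add_of_pos_right C hδ)
  change r i x * _ ≤ r i x * _
  by_cases hri : r i x = 0
  · simp [hri]
  have hvi : v i ≠ 0 := fun h => hri (by simp [hr_def, h])
  have hfi := not_imp_comm.1 (hrf i x) hri
  refine mul_le_mul_of_nonneg_left ?_ (hr0 i x)
  rcases hu i with hui | hui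
  · have hcard : (Finset.univ.filter fun j =>
        Function.update u i (SignType.sign (v i)) j = 0 ∧ v j ≠ 0).card < k := by
      rw [← hk]
      refine Finset.card_lt_card (Finset.ssubset_iff_of_subset ?_ |>.2 ⟨i, ?_, ?_⟩)
      · intro j
        by_cases hji : j = i
        · subst hji
          simp +contextual [hui]
        · simp [Function.update_of_ne hji]
      · simp [hui, hvi]
      · simp [hvi]
    have hind := ih _ hcard _ (hupd i) hfi hx0 rfl
    have : 0 ≤ δ * x := by positivity
    linarith
  -- Coordinate i is already pinned, so the child is u itself and both differences vanish.
  · rw [← hui, Function.update_eq_self]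
    simp

lemma feasible_zero (ν : Measure (Cube n)) [IsProbabilityMeasure ν] :
    Feasible ν (0 : Fin n → SignType) := by
  have : pinEvent (0 : Fin n → SignType) = Set.univ := by ext; simp [pinEvent]
  simp [Feasible, this]

end SparseLocalization

open SparseLocalization
theorem mainTheorem3 (n : ℕ) (ν : MeasureTheory.Measure (Cube n))
    [MeasureTheory.IsProbabilityMeasure ν]
    (V : Set (EuclideanSpace ℝ (Fin n))) (hV : (0 : EuclideanSpace ℝ (Fin n)) ∈ V)
    (α : ℝ) (hα : 0 < α) (hν : IsL2IndependentOn ν α (signClosure V)) :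
    ∀ v ∈ V, ‖mean (tilt v ν) - mean ν‖ ≤ 4 * α * ‖v‖ := by
  intro v hv
  set y := mean (tilt v ν) - mean ν with hy
  have : IsProbabilityMeasure (tilt v ν) := isProbabilityMeasure_tilted Integrable.of_finite
  have hpin : pin 0 ν = ν := by
    have : pinEvent (0 : Fin n → SignType) = Set.univ := by ext; simp [pinEvent]
    simp [pin, this]
  -- Testing against y itself gives ‖y‖² ≤ 4α‖v‖‖y‖.
  have h := pinnedTiltMean_sub_le (fun u hu => hν u ⟨v, hv, hu⟩) y 0 (fun i => Or.inl rfl)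
    (feasible_zero ν) zero_le_one
  rw [← integral_tilt, ← integral_pin, hpin, ← inner_mean, ← inner_mean, ← inner_sub_right, ← hy,
    real_inner_self_eq_norm_mul_norm, mul_one] at h
  rcases (norm_nonneg y).eq_or_lt with h0 | h0
  · rw [← h0]
    positivity
  · exact le_of_mul_le_mul_right h h0
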